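/- Let $n\ge 0$ and let $f,g_1,\dots,g_n\in\mathbb{R}[x_1,\dots,x_n]$. Write $\deg$ for the total degree (with $\deg 0=0$), and let $p^\infty$ be the sum of the terms of $p$ of degree $\deg p$. Let $W=\{x\in\mathbb{R}^n: g_1(x)=\cdots=g_n(x)=0\}$ and $f_*=\inf_{x\in W}f(x)\in[-\infty,+\infty]$ (so $f_*=+\infty$ if $W=\emptyset$). For an integer $d\ge 0$ let $f_d\in[-\infty,+\infty]$ be the optimal value of Lasserre's relaxation of order $d$, that is, the supremum of all $c\in\mathbb{R}$ for which there are polynomials $\lambda_1,\dots,\lambda_n,\sigma\in\mathbb{R}[x_1,\dots,x_n]$ such that $$f-c=\sum_{i=1}^n\lambda_i g_i+\sigma,\qquad \deg(\lambda_i g_i)\le 2d\ \ (1\le i\le n),\qquad \deg(\sigma)\le 2d,\qquad \sigma\text{ is a sum of squares of polynomials}.$$ Call $d$ admissible if $d\ge 1$ and $2d\ge\deg g_i$ for all $i$. (a) Assume that the system $g_1^\infty(z)=\cdots=g_n^\infty(z)=0$ has no solution in $\mathbb{C}^n\setminus\{0\}$. Then $f_d=f_*$ for some $$0\le d\le\left\lceil\max\left(\sum_{i=1}^n\deg(g_i)-n,\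 \frac{\deg(f)}{2}\right)\right\rceil.$$ Moreover, $d$ can be chosen admissible provided that no $g_i$ is constant and that $f$ is nonconstant or some $g_i$ has degree at least $2$. (b) Under the assumption of (a) the value $f_d$ need not be attained: there are $n$, $f$ and $g_1,\dots,g_n$ that satisfy the assumption of (a), with $W\neq\emptyset$, such that for every admissible $d$ one has $f_d=f_*$, but the supremum defining $f_d$ is not attained. -/

import Mathlib

open MvPolynomial

noncomputable section

namespace Lasserre

variable {n : ℕ}

/-- The form of highest degree `p^∞` of `p`: the sum of the terms of `p` of degree `deg p`. -/
def topForm (p : MvPolynomial (Fin n) ℝ) : MvPolynomial (Fin n) ℝ :=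
  homogeneousComponent p.totalDegree p

/-- The system `g₁^∞(z) = ⋯ = gₙ^∞(z) = 0` has no solution in `ℂⁿ \ {0}`. -/
def NoZeroAtInfinity (g : Fin n → MvPolynomial (Fin n) ℝ) : Prop :=
  ¬ ∃ z : Fin n → ℂ, z ≠ 0 ∧ ∀ i, aeval z (topForm (g i)) = 0

/-- The feasible region `{x ∈ ℝⁿ : g₁(x) = ⋯ = gₙ(x) = 0}`. -/
def feasibleSet (g : Fin n → MvPolynomial (Fin n) ℝ) : Set (Fin n → ℝ) :=
  {x | ∀ i, eval x (g i) = 0}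

/-- The optimal value `f_*` of minimizing `f` over the feasible region, as an extended real
(`+∞` if there is no feasible point). -/
def optValue (f : MvPolynomial (Fin n) ℝ) (g : Fin n → MvPolynomial (Fin n) ℝ) : EReal :=
  ⨅ x ∈ feasibleSet g, ((eval x f : ℝ) : EReal)

/-- `c` is feasible for the relaxation of order `d`: `f - c = ∑ qᵢ gᵢ + σ` with
`deg (qᵢ gᵢ) ≤ 2d`, `deg σ ≤ 2d` and `σ` a sum of squares of polynomials. -/
def RelaxationFeasible (f : MvPolynomial (Fin n) ℝ) (g : Fin n → MvPolynomial (Fin n) ℝ)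
    (d : ℕ) (c : ℝ) : Prop :=
  ∃ (q : Fin n → MvPolynomial (Fin n) ℝ) (σ : MvPolynomial (Fin n) ℝ),
    f - C c = ∑ i, q i * g i + σ ∧
    (∀ i, (q i * g i).totalDegree ≤ 2 * d) ∧
    σ.totalDegree ≤ 2 * d ∧
    IsSumSq σ

/-- The optimal value `f_d` of Lasserre's relaxation of order `d`, as an extended real
(`-∞` if the relaxation is infeasible, `+∞` if it is unbounded). -/
def relaxationValue (f : MvPolynomial (Fin n) ℝ) (g : Fin n → MvPolynomial (Fin n) ℝ)
    (d : ℕ) : EReal :=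
  ⨆ c ∈ {c : ℝ | RelaxationFeasible f g d c}, (c : EReal)

/-- The supremum defining `f_d` is attained. -/
def RelaxationAttained (f : MvPolynomial (Fin n) ℝ) (g : Fin n → MvPolynomial (Fin n) ℝ)
    (d : ℕ) : Prop :=
  ∃ c : ℝ, RelaxationFeasible f g d c ∧ relaxationValue f g d = (c : EReal)

/-- `d` is an admissible relaxation order: `d` is positive and `d ≥ maxᵢ deg(gᵢ) / 2`. -/
def AdmissibleOrder (g : Fin n → MvPolynomial (Fin n) ℝ) (d : ℕ) : Prop :=
  1 ≤ d ∧ ∀ i, (g i).totalDegree ≤ 2 * d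

/-- The number `⌈max (∑ deg gᵢ - n, deg f / 2)⌉`. -/
def degreeBound (f : MvPolynomial (Fin n) ℝ) (g : Fin n → MvPolynomial (Fin n) ℝ) : ℤ :=
  ⌈max ((∑ i, ((g i).totalDegree : ℝ)) - (n : ℝ)) ((f.totalDegree : ℝ) / 2)⌉

end Lasserre

end

/-! Fix `c < f_*`. The quotient of the polynomial ring by `I = (g₁, …, gₙ)` is finite-dimensional
and `f - c` is positive at its real points, so `f - c` is a sum of two squares modulo `I`
(`exists_sq_add_sq`). Two facts about the leading forms `h i` then control degrees. Macaulay's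
bound, that every form of degree above `∑ d i - n` lies in `(h)`, lets both squared elements be
reduced to degree at most `∑ d i - n` (`exists_reduction`). Exactness of the Koszul complex in its
first syzygies lets members of `I` be written without cancellation of leading terms
(`exists_representation`). Together they give a certificate of order `d`.

Both facts are packaged in `IsFormParameters`. They are elementary for powers of the variables and
are carried to the `h i` by replacing one form at a time (`IsFormParameters.update`). Such a
replacement needs a power of the old form in the new ideal. Generic linear combinations achieve this
when all degrees agree (`exists_generic`); for unequal degrees the forms are first raised to powers
of a common degree, and these powers are then replaced by the forms themselves. The Nullstellensatz
turns the hypothesis at infinity into powers of the variables lying in `(h)`.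

For (b), minimize `x` subject to `x² = 0`: the value `0` is approached from below, but a sum of
squares vanishing at a point has zero gradient there. -/

noncomputable section

namespace Lasserre

/-! ### Homogeneous components and degree bounds indexed by integers -/

section Graded

variable {σ K : Type*} [CommRing K]

/-- The homogeneous component of degree `e`, indexed by an integer (zero for negative `e`). -/
def hcomp (e : ℤ) : MvPolynomial σ K →ₗ[K] MvPolynomial σ K :=
  if 0 ≤ e then homogeneousComponent e.toNat else 0

/-- All monomials of `p` have degree at most the integer `e`. -/
def DegLE (e : ℤ) (p : MvPolynomial σ K) : Prop :=
  ∀ m, coeff m p ≠ 0 → (m.degree : ℤ) ≤ e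

lemma coeff_hcomp (e : ℤ) (p : MvPolynomial σ K) (m : σ →₀ ℕ) :
    coeff m (hcomp e p) = if (m.degree : ℤ) = e then coeff m p else 0 := by
  unfold hcomp
  split_ifs with h1 h2 h2
  · rw [coeff_homogeneousComponent, if_pos (by omega)]
  · rw [coeff_homogeneousComponent, if_neg (by omega)]
  · omega
  · simp

lemma hcomp_natCast (e : ℕ) (p : MvPolynomial σ K) :
    hcomp (e : ℤ) p = homogeneousComponent e p := by
  simp [hcomp]

lemma hcomp_of_isHomogeneous {p : MvPolynomial σ K} {t : ℕ} (hp : p.IsHomogeneous t) (e : ℤ) :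
    hcomp e p = if e = t then p else 0 := by
  ext m
  rw [coeff_hcomp]
  by_cases hm : coeff m p = 0
  · split_ifs <;> simp [hm]
  · have : m.degree = t := by
      by_contra h
      exact hm (hp.coeff_eq_zero h)
    subst this
    by_cases h : (m.degree : ℤ) = e
    · simp [h]
    · rw [if_neg h, if_neg (fun h' => h h'.symm), coeff_zero]

lemma hcomp_hcomp (e : ℤ) (p : MvPolynomial σ K) : hcomp e (hcomp e p) = hcomp e p := by
  ext m
  simp only [coeff_hcomp]
  split_ifs <;> rfl

lemma hcomp_mul {h : MvPolynomial σ K} {d : ℕ} (hh : h.IsHomogeneous d) (e : ℤ)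
    (p : MvPolynomial σ K) : hcomp e (p * h) = hcomp (e - d) p * h := by
  classical
  ext m
  rw [coeff_hcomp, coeff_mul, coeff_mul]
  rw [← Finset.sum_filter_add_sum_filter_not (Finset.HasAntidiagonal.antidiagonal m) (fun x => coeff x.2 h = 0)]
  have key : ∀ x ∈ Finset.HasAntidiagonal.antidiagonal m, coeff x.1 (hcomp (e - d) p) * coeff x.2 h =
      if (m.degree : ℤ) = e then coeff x.1 p * coeff x.2 h else 0 := by
    intro x hx
    rw [Finset.HasAntidiagonal.mem_antidiagonal] at hx
    by_cases h0 : coeff x.2 h = 0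
    · simp [h0]
    · have h2 : x.2.degree = d := by
        by_contra h'
        exact h0 (hh.coeff_eq_zero h')
      have h3 : m.degree = x.1.degree + d := by rw [← hx, map_add, h2]
      rw [coeff_hcomp]
      by_cases h4 : (m.degree : ℤ) = e
      · rw [if_pos h4, if_pos (by omega)]
      · rw [if_neg h4, if_neg (by omega), zero_mul]
  rw [Finset.sum_congr rfl key, Finset.sum_filter_add_sum_filter_not]
  split_ifs <;> simp

namespace DegLE

variable {e e' : ℤ} {p q : MvPolynomial σ K}

lemma zero (e : ℤ) : DegLE e (0 : MvPolynomial σ K) := fun m hm => by simp at hm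

lemma mono (hp : DegLE e p) (h : e ≤ e') : DegLE e' p := fun m hm => (hp m hm).trans h

lemma add (hp : DegLE e p) (hq : DegLE e q) : DegLE e (p + q) := by
  intro m hm
  rw [coeff_add] at hm
  by_cases h : coeff m p = 0
  · exact hq m (by simpa [h] using hm)
  · exact hp m h

lemma neg (hp : DegLE e p) : DegLE e (-p) := fun m hm => hp m (by simpa using hm)

lemma sub (hp : DegLE e p) (hq : DegLE e q) : DegLE e (p - q) := by
  rw [sub_eq_add_neg]; exact hp.add hq.neg

lemma sum {ι : Type*} (s : Finset ι) {f : ι → MvPolynomial σ K} (hf : ∀ i ∈ s, DegLE e (f i)) :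
    DegLE e (∑ i ∈ s, f i) := by
  classical
  induction s using Finset.induction_on with
  | empty => simpa using zero e
  | insert a s ha ih =>
    rw [Finset.sum_insert ha]
    exact (hf a (by simp)).add (ih fun i hi => hf i (by simp [hi]))

lemma mul (hp : DegLE e p) (hq : DegLE e' q) : DegLE (e + e') (p * q) := by
  classical
  intro m hm
  rw [coeff_mul] at hm
  obtain ⟨x, hx, hx'⟩ := Finset.exists_ne_zero_of_sum_ne_zero hm
  rw [Finset.HasAntidiagonal.mem_antidiagonal] at hx
  have h1 := hp x.1 (left_ne_zero_of_mul hx')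
  have h2 := hq x.2 (right_ne_zero_of_mul hx')
  have h3 : m.degree = x.1.degree + x.2.degree := by rw [← hx, map_add]
  omega

lemma hcomp_self (e : ℤ) (p : MvPolynomial σ K) : DegLE e (hcomp e p) := by
  intro m hm
  rw [coeff_hcomp] at hm
  split_ifs at hm with h
  · exact h.le
  · exact absurd rfl hm

lemma sub_hcomp (hp : DegLE e p) : DegLE (e - 1) (p - hcomp e p) := by
  intro m hm
  rw [coeff_sub, coeff_hcomp] at hm
  split_ifs at hm with h
  · simp at hm
  · have := hp m (by simpa using hm)
    omega

lemma hcomp_eq_zero (hp : DegLE e p) (h : e < e') : hcomp e' p = 0 := by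
  ext m
  rw [coeff_hcomp]
  split_ifs with h'
  · by_contra hm
    have := hp m hm
    omega
  · simp

lemma of_isHomogeneous {t : ℕ} (hp : p.IsHomogeneous t) : DegLE t p := by
  have := hcomp_self (t : ℤ) p
  rwa [hcomp_of_isHomogeneous hp, if_pos rfl] at this

end DegLE

lemma degLE_natCast_iff {e : ℕ} {p : MvPolynomial σ K} : DegLE (e : ℤ) p ↔ p.totalDegree ≤ e := by
  have hdeg : ∀ m : σ →₀ ℕ, (m.sum fun _ e => e) = m.degree := fun m => rfl
  rw [totalDegree, Finset.sup_le_iff]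
  simp only [hdeg, DegLE, mem_support_iff, Nat.cast_le]

lemma degLE_totalDegree (p : MvPolynomial σ K) : DegLE (p.totalDegree : ℤ) p :=
  degLE_natCast_iff.2 le_rfl

/-- An ideal is stable under taking homogeneous components if it is spanned by forms. -/
lemma hcomp_mem_span {s : Set (MvPolynomial σ K)} (hs : ∀ x ∈ s, ∃ d, x.IsHomogeneous d)
    {p : MvPolynomial σ K} (hp : p ∈ Ideal.span s) (e : ℤ) : hcomp e p ∈ Ideal.span s := by
  induction hp using Submodule.closure_induction with
  | zero => simp
  | add x y _ _ hx hy => rw [map_add]; exact add_mem hx hy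
  | smul_mem r x hx =>
    obtain ⟨d, hd⟩ := hs x hx
    rw [smul_eq_mul, hcomp_mul hd]
    exact Ideal.mul_mem_left _ _ (Ideal.subset_span hx)

end Graded

/-! ### First syzygies and Koszul exactness -/

section Koszul

lemma span_range_update {ι R : Type*} [CommRing R] [DecidableEq ι] (h : ι → R) (i : ι) (c : R) :
    Ideal.span (Set.range (Function.update h i c)) =
      Ideal.span (h '' {i}ᶜ) ⊔ Ideal.span {c} := by
  rw [← Ideal.span_union]
  congr 1
  ext x
  constructor
  · rintro ⟨j, rfl⟩
    by_cases hj : j = i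
    · subst hj; simp
    · left; exact ⟨j, hj, by simp [hj]⟩
  · rintro (⟨j, hj, rfl⟩ | rfl)
    · exact ⟨j, by simp [show j ≠ i from hj]⟩
    · exact ⟨i, by simp⟩

lemma span_range_eq_sup {ι R : Type*} [CommRing R] [DecidableEq ι] (h : ι → R) (i : ι) :
    Ideal.span (Set.range h) = Ideal.span (h '' {i}ᶜ) ⊔ Ideal.span {h i} := by
  conv_lhs => rw [← Function.update_eq_self i h]
  exact span_range_update h i (h i)

lemma mem_sup_span_singleton {R : Type*} [CommRing R] {J : Ideal R} {c x : R} :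
    x ∈ J ⊔ Ideal.span {c} ↔ ∃ j ∈ J, ∃ u, x = j + u * c := by
  simp only [Submodule.mem_sup, Ideal.mem_span_singleton']
  constructor
  · rintro ⟨j, hj, _, ⟨u, rfl⟩, rfl⟩
    exact ⟨j, hj, u, rfl⟩
  · rintro ⟨j, hj, u, rfl⟩
    exact ⟨j, hj, _, ⟨u, rfl⟩, rfl⟩

variable {ι R : Type*} [Fintype ι] [CommRing R]

/-- The Koszul (trivial) syzygies of a family `h`: the vectors `A h` with `A` antisymmetric. -/
def koszulSyz (h : ι → R) : Submodule R (ι → R) where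
  carrier := {a | ∃ A : ι → ι → R, (∀ i j, A i j = -A j i) ∧ ∀ i, a i = ∑ j, A i j * h j}
  zero_mem' := ⟨0, by simp, by simp⟩
  add_mem' := by
    rintro a b ⟨A, hA, ha⟩ ⟨B, hB, hb⟩
    refine ⟨fun i j => A i j + B i j, fun i j => ?_, fun i => ?_⟩
    · dsimp only; rw [hA i j, hB i j]; ring
    · simp [ha, hb, add_mul, Finset.sum_add_distrib]
  smul_mem' := by
    rintro c a ⟨A, hA, ha⟩
    refine ⟨fun i j => c * A i j, fun i j => ?_, fun i => ?_⟩
    · dsimp only; rw [hA i j]; ring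
    · simp [ha, mul_assoc, Finset.mul_sum]

/-- Every syzygy of the family `h` is a Koszul syzygy. -/
def KoszulExact (h : ι → R) : Prop :=
  ∀ a : ι → R, ∑ i, a i * h i = 0 → a ∈ koszulSyz h

/-- Swapping the two summation indices shows that the sum equals its own negative. -/
lemma sum_antisymm_eq_zero [IsDomain R] [CharZero R] {A : ι → ι → R}
    (hA : ∀ i j, A i j = -A j i) (h : ι → R) : ∑ i, (∑ j, A i j * h j) * h i = 0 := by
  have : ∑ i, (∑ j, A i j * h j) * h i = -∑ i, (∑ j, A i j * h j) * h i := by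
    conv_lhs => simp only [Finset.sum_mul]
    rw [Finset.sum_comm]
    simp only [Finset.sum_mul, ← Finset.sum_neg_distrib]
    refine Finset.sum_congr rfl fun i _ => Finset.sum_congr rfl fun j _ => ?_
    rw [hA j i]; ring
  exact self_eq_neg.mp this

lemma sum_mul_eq_zero_of_mem_koszulSyz [IsDomain R] [CharZero R] {h a : ι → R}
    (ha : a ∈ koszulSyz h) : ∑ i, a i * h i = 0 := by
  obtain ⟨A, hA, ha⟩ := ha
  simp only [ha]
  exact sum_antisymm_eq_zero hA h

variable [DecidableEq ι]

/-- The ideal of a family annihilates its syzygies modulo the Koszul syzygies. -/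
lemma smul_mem_koszulSyz {h a : ι → R} (ha : ∑ i, a i * h i = 0) {x : R}
    (hx : x ∈ Ideal.span (Set.range h)) : x • a ∈ koszulSyz h := by
  induction hx using Submodule.span_induction with
  | zero => simp
  | add x y _ _ hx hy => rw [add_smul]; exact add_mem hx hy
  | smul r x _ hx => rw [smul_assoc]; exact Submodule.smul_mem _ _ hx
  | mem x hx =>
    obtain ⟨k, rfl⟩ := hx
    -- The matrix is `a eₖᵀ - eₖ aᵀ`: applied to `h` it gives `h k • a` minus a multiple of `∑ a j *
    -- h j = 0`.
    refine ⟨fun i j => (if j = k then a i else 0) - (if i = k then a j else 0),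
      fun i j => by ring, fun i => ?_⟩
    simp only [sub_mul, Finset.sum_sub_distrib, ite_mul, zero_mul, Finset.sum_ite_eq',
      Finset.mem_univ, if_true]
    by_cases hi : i = k <;> simp [hi, ha, mul_comm (h k)]

/-- Every member of the ideal of the other elements is the `i`-th entry of a Koszul syzygy. -/
lemma exists_koszulSyz_apply_eq (h : ι → R) (i : ι) {x : R} (hx : x ∈ Ideal.span (h '' {i}ᶜ)) :
    ∃ κ ∈ koszulSyz h, κ i = x := by
  induction hx using Submodule.span_induction with
  | zero => exact ⟨0, zero_mem _, rfl⟩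
  | add x y _ _ hx hy =>
    obtain ⟨a, ha, rfl⟩ := hx
    obtain ⟨b, hb, rfl⟩ := hy
    exact ⟨a + b, add_mem ha hb, rfl⟩
  | smul r x _ hx =>
    obtain ⟨a, ha, rfl⟩ := hx
    exact ⟨r • a, Submodule.smul_mem _ _ ha, rfl⟩
  | mem x hx =>
    obtain ⟨k, hk, rfl⟩ := hx
    have hk : k ≠ i := hk
    refine ⟨_, ⟨fun a b => (if a = i ∧ b = k then 1 else 0) - (if b = i ∧ a = k then 1 else 0),
      fun a b => by ring, fun _ => rfl⟩, ?_⟩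
    simp [hk.symm]

/-- A member of a Koszul exact family is regular modulo the other members. -/
lemma KoszulExact.mem_of_mul_mem [IsDomain R] [CharZero R] {h : ι → R} (hh : KoszulExact h)
    (i : ι) {u : R} (hu : u * h i ∈ Ideal.span (h '' {i}ᶜ)) : u ∈ Ideal.span (h '' {i}ᶜ) := by
  have h1 : ∀ x ∈ Ideal.span (h '' {i}ᶜ), ∃ a : ι → R, a i = 0 ∧ ∑ j, a j * h j = x := by
    intro x hx
    induction hx using Submodule.span_induction with
    | zero => exact ⟨0, rfl, by simp⟩
    | add x y _ _ hx hy =>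
      obtain ⟨a, ha, rfl⟩ := hx
      obtain ⟨b, hb, rfl⟩ := hy
      exact ⟨a + b, by simp [ha, hb], by simp [add_mul, Finset.sum_add_distrib]⟩
    | smul r x _ hx =>
      obtain ⟨a, ha, rfl⟩ := hx
      exact ⟨r • a, by simp [ha], by simp [Finset.mul_sum, mul_assoc]⟩
    | mem x hx =>
      obtain ⟨k, hk, rfl⟩ := hx
      exact ⟨Pi.single k 1, Pi.single_eq_of_ne (Ne.symm hk) _, by simp [Pi.single_apply]⟩
  obtain ⟨a, hai, ha⟩ := h1 _ hu
  -- The `i`-th entry of this syzygy is `u`, and the diagonal of an antisymmetric matrix vanishes,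
  -- so `u` involves only the other members.
  obtain ⟨A, hA, hA'⟩ := hh (Pi.single i u - a) (by
    simp [sub_mul, Finset.sum_sub_distrib, Pi.single_apply, ha])
  have h2 := hA' i
  simp only [Pi.sub_apply, Pi.single_eq_same, hai, sub_zero] at h2
  rw [h2]
  refine Ideal.sum_mem _ fun j _ => ?_
  by_cases hj : j = i
  · subst hj
    rw [self_eq_neg.mp (hA j j), zero_mul]
    exact zero_mem _
  · exact Ideal.mul_mem_left _ _ (Ideal.subset_span ⟨j, hj, rfl⟩)

lemma KoszulExact.mem_of_mul_pow_mem [IsDomain R] [CharZero R] {h : ι → R} (hh : KoszulExact h)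
    (i : ι) (e : ℕ) {u : R} (hu : u * h i ^ e ∈ Ideal.span (h '' {i}ᶜ)) :
    u ∈ Ideal.span (h '' {i}ᶜ) := by
  induction e with
  | zero => simpa using hu
  | succ e ih => exact ih (hh.mem_of_mul_mem i (by rwa [mul_assoc, ← pow_succ]))

/-- Exchange: if a power of `h i` lies in the ideal of the family with `h i` replaced by `c`,
then the new family is Koszul exact as well. -/
theorem KoszulExact.update [IsDomain R] [CharZero R] {h : ι → R} (hh : KoszulExact h)
    (i : ι) {c : R} {e : ℕ}
    (he : h i ^ e ∈ Ideal.span (Set.range (Function.update h i c))) :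
    KoszulExact (Function.update h i c) := by
  set h' := Function.update h i c with hh'
  have hJ : Set.image h' {i}ᶜ = Set.image h {i}ᶜ := by
    refine Set.image_congr fun j hj => ?_
    rw [hh', Function.update_of_ne hj]
  have hsum : ∀ a : ι → R, a i = 0 → ∑ j, a j * h' j = ∑ j, a j * h j := by
    intro a ha
    refine Finset.sum_congr rfl fun j _ => ?_
    by_cases hj : j = i
    · subst hj; simp [ha]
    · rw [hh', Function.update_of_ne hj]
  -- Write `a = A h`. Deleting row and column `i` of `A` leaves a Koszul syzygy of `h'`, and the
  -- remainder is `h i` times column `i` of `A`. That column is again a syzygy, because row `i`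
  -- gives `a i = 0`.
  have step : ∀ a : ι → R, a i = 0 → ∑ j, a j * h j = 0 →
      ∃ a' : ι → R, a' i = 0 ∧ ∑ j, a' j * h j = 0 ∧ a - h i • a' ∈ koszulSyz h' := by
    intro a hai ha
    obtain ⟨A, hA, hA'⟩ := hh a ha
    refine ⟨fun j => A j i, self_eq_neg.mp (hA i i), ?_, ?_⟩
    · have := hA' i
      rw [hai] at this
      rw [← neg_eq_zero, ← Finset.sum_neg_distrib, this]
      exact Finset.sum_congr rfl fun j _ => by dsimp only; rw [hA j i]; ring
    · refine ⟨fun j k => if j = i ∨ k = i then 0 else A j k, fun j k => ?_, fun j => ?_⟩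
      · dsimp only
        rw [hA j k]
        by_cases h1 : j = i <;> by_cases h2 : k = i <;> simp [h1, h2]
      · by_cases hj : j = i
        · subst hj
          simp [hai, self_eq_neg.mp (hA j j)]
        · simp only [Pi.sub_apply, Pi.smul_apply, smul_eq_mul, hA' j]
          rw [sub_eq_iff_eq_add, ← Finset.sum_erase_add _ _ (Finset.mem_univ i),
            ← Finset.sum_erase_add (a := i) _ _ (Finset.mem_univ i)]
          simp only [hj, or_true, if_true, zero_mul, add_zero, false_or]
          rw [mul_comm (A j i)]
          congr 1
          refine Finset.sum_congr rfl fun k hk => ?_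
          have hk := Finset.ne_of_mem_erase hk
          rw [if_neg hk, hh', Function.update_of_ne hk]
  have steps : ∀ (k : ℕ) (a : ι → R), a i = 0 → ∑ j, a j * h j = 0 →
      ∃ a' : ι → R, a' i = 0 ∧ ∑ j, a' j * h j = 0 ∧ a - h i ^ k • a' ∈ koszulSyz h' := by
    intro k
    induction k with
    | zero => exact fun a h1 h2 => ⟨a, h1, h2, by simp⟩
    | succ k ih =>
      intro a h1 h2
      obtain ⟨a', h1', h2', h3'⟩ := ih a h1 h2
      obtain ⟨a'', h1'', h2'', h3''⟩ := step a' h1' h2'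
      refine ⟨a'', h1'', h2'', ?_⟩
      have : a - h i ^ (k + 1) • a'' = (a - h i ^ k • a') + h i ^ k • (a' - h i • a'') := by
        rw [smul_sub, smul_smul, pow_succ]; abel
      rw [this]
      exact add_mem h3' (Submodule.smul_mem _ _ h3'')
  intro a ha
  -- Modulo the other members, `a i * c` vanishes and `h i ^ e` is a multiple of `c`, so `a i * h i
  -- ^ e` vanishes; now use regularity of `h i`.
  have hai : a i ∈ Ideal.span (h '' {i}ᶜ) := by
    apply hh.mem_of_mul_pow_mem i e
    rw [hh', span_range_update] at he
    obtain ⟨j, hj, u, hu⟩ := mem_sup_span_singleton.1 he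
    rw [hu, mul_add]
    refine add_mem (Ideal.mul_mem_left _ _ hj) ?_
    have : a i * (u * c) = u * (a i * h' i) := by simp [hh']; ring
    rw [this]
    refine Ideal.mul_mem_left _ _ ?_
    rw [← Finset.add_sum_erase _ _ (Finset.mem_univ i), add_eq_zero_iff_eq_neg] at ha
    rw [ha, neg_mem_iff]
    refine Ideal.sum_mem _ fun k hk => Ideal.mul_mem_left _ _ ?_
    rw [← hJ]
    exact Ideal.subset_span ⟨k, Finset.ne_of_mem_erase hk, rfl⟩
  rw [← hJ] at hai
  obtain ⟨κ, hκ, hκi⟩ := exists_koszulSyz_apply_eq h' i hai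
  have h0 : (a - κ) i = 0 := by simp [hκi]
  have h1 : ∑ j, (a - κ) j * h' j = 0 := by
    simp [sub_mul, Finset.sum_sub_distrib, ha, sum_mul_eq_zero_of_mem_koszulSyz hκ]
  obtain ⟨a', h0', h1', h2'⟩ := steps e (a - κ) h0 (by rw [← hsum _ h0, h1])
  -- After extracting `e` factors `h i`, the coefficient lies in the ideal of the new family, which
  -- sends syzygies to Koszul syzygies.
  have h3 : h i ^ e • a' ∈ koszulSyz h' := smul_mem_koszulSyz (by rw [hsum _ h0', h1']) he
  have : a = κ + ((a - κ - h i ^ e • a') + h i ^ e • a') := by abel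
  rw [this]
  exact add_mem hκ (add_mem h2' h3)

/-- A family each of whose members is regular modulo any set of other members is Koszul exact. -/
theorem koszulExact_of_regular {h : ι → R}
    (hreg : ∀ (s : Finset ι) (i : ι), i ∉ s → ∀ u : R, u * h i ∈ Ideal.span (h '' s) →
      u ∈ Ideal.span (h '' s)) [IsDomain R] [CharZero R] : KoszulExact h := by
  have main : ∀ s : Finset ι, ∀ a : ι → R, (∀ i ∉ s, a i = 0) → ∑ i, a i * h i = 0 →
      a ∈ koszulSyz h := by
    intro s
    induction s using Finset.induction_on with
    | empty =>
      intro a ha _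
      have : a = 0 := funext fun i => ha i (by simp)
      rw [this]; exact zero_mem _
    | insert i s hi ih =>
      intro a ha hs
      have hai : a i ∈ Ideal.span (h '' s) := by
        apply hreg s i hi
        rw [← Finset.add_sum_erase _ _ (Finset.mem_univ i), add_eq_zero_iff_eq_neg] at hs
        rw [hs, neg_mem_iff]
        refine Ideal.sum_mem _ fun k hk => ?_
        by_cases hks : k ∈ s
        · exact Ideal.mul_mem_left _ _ (Ideal.subset_span ⟨k, hks, rfl⟩)
        · rw [ha k (by simp [hks, Finset.ne_of_mem_erase hk]), zero_mul]
          exact zero_mem _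
      -- Control of the support is essential: subtracting `κ` must leave a syzygy supported on `s`,
      -- to which induction applies.
      have h1 : ∀ x ∈ Ideal.span (h '' s), ∃ κ ∈ koszulSyz h, κ i = x ∧
          ∀ j ∉ insert i s, κ j = 0 := by
        intro x hx
        induction hx using Submodule.span_induction with
        | zero => exact ⟨0, zero_mem _, rfl, by simp⟩
        | add x y _ _ hx hy =>
          obtain ⟨a, ha, rfl, ha'⟩ := hx
          obtain ⟨b, hb, rfl, hb'⟩ := hy
          exact ⟨a + b, add_mem ha hb, rfl, fun j hj => by simp [ha' j hj, hb' j hj]⟩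
        | smul r x _ hx =>
          obtain ⟨a, ha, rfl, ha'⟩ := hx
          exact ⟨r • a, Submodule.smul_mem _ _ ha, rfl, fun j hj => by simp [ha' j hj]⟩
        | mem x hx =>
          obtain ⟨k, hk, rfl⟩ := hx
          have hki : k ≠ i := fun h' => hi (h' ▸ hk)
          refine ⟨_, ⟨fun a b => (if a = i ∧ b = k then 1 else 0) -
            (if b = i ∧ a = k then 1 else 0), fun a b => by ring, fun _ => rfl⟩, ?_, ?_⟩
          · simp [hki.symm]
          · intro j hj
            have h1 : j ≠ i := fun h' => hj (by simp [h'])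
            have h2 : j ≠ k := fun h' => hj (by rw [h']; exact Finset.mem_insert_of_mem hk)
            simp [h1, h2]
      obtain ⟨κ, hκ, hκi, hκs⟩ := h1 _ hai
      have h2 := ih (a - κ) (fun j hj => by
        by_cases hji : j = i
        · subst hji; simp [hκi]
        · have : j ∉ insert i s := by simp [hji, hj]
          simp [ha j this, hκs j this]) (by
        simp [sub_mul, Finset.sum_sub_distrib, hs, sum_mul_eq_zero_of_mem_koszulSyz hκ])
      have := add_mem h2 hκ
      rwa [sub_add_cancel] at this
  exact fun a ha => main Finset.univ a (by simp) ha

/-- Koszul exactness is invariant under an invertible linear change of the family. -/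
lemma KoszulExact.of_matrix {h c : ι → R} {T U : Matrix ι ι R} (hTU : U * T = 1)
    (hc : ∀ i, c i = ∑ j, T i j * h j) (hh : KoszulExact c) : KoszulExact h := by
  have hUT : T * U = 1 := mul_eq_one_comm.1 hTU
  have hc' : c = T.mulVec h := funext fun i => by rw [hc]; rfl
  have hh' : h = U.mulVec c := by rw [hc', Matrix.mulVec_mulVec, hTU, Matrix.one_mulVec]
  intro a ha
  have h1 : Matrix.vecMul a U ⬝ᵥ c = 0 := by
    rw [← Matrix.dotProduct_mulVec, ← hh']; exact ha
  obtain ⟨A, hA, hA'⟩ := hh _ h1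
  have h2 : a = (Matrix.transpose T * Matrix.of A * T).mulVec h := by
    have h3 : Matrix.vecMul a U = (Matrix.of A).mulVec c := funext hA'
    calc a = Matrix.vecMul (Matrix.vecMul a U) T := by
            rw [Matrix.vecMul_vecMul, hTU, Matrix.vecMul_one]
      _ = _ := by
        rw [h3, hc', ← Matrix.mulVec_transpose, Matrix.mulVec_mulVec, Matrix.mulVec_mulVec]
  have hAt : (Matrix.of A).transpose = -Matrix.of A := by
    ext i j; exact hA j i
  refine ⟨Matrix.transpose T * Matrix.of A * T, fun i j => ?_, fun i => congrFun h2 i⟩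
  have : (Matrix.transpose T * Matrix.of A * T).transpose =
      -(Matrix.transpose T * Matrix.of A * T) := by
    rw [Matrix.transpose_mul, Matrix.transpose_mul, hAt, Matrix.transpose_transpose,
      ← Matrix.mul_assoc, Matrix.mul_neg, Matrix.neg_mul]
  have := congrFun (congrFun this j) i
  simpa using this

end Koszul

/-! ### Degree thresholds beyond which an ideal contains all forms -/

section FormsAbove

variable {σ K : Type*} [CommRing K]

lemma isHomogeneous_hcomp {e : ℤ} (he : 0 ≤ e) (p : MvPolynomial σ K) :
    (hcomp e p).IsHomogeneous e.toNat := by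
  rw [hcomp, if_pos he]
  exact homogeneousComponent_isHomogeneous _ _

/-- The ideal `I` contains every form of degree greater than `B`. -/
def ContainsFormsAbove (I : Ideal (MvPolynomial σ K)) (B : ℤ) : Prop :=
  ∀ (p : MvPolynomial σ K) (t : ℤ), B < t → hcomp t p ∈ I

variable {J : Ideal (MvPolynomial σ K)} {b c : MvPolynomial σ K} {m k : ℕ} {B : ℤ}

/-- A form above the threshold is `j + q * b` with `q` of degree smaller by `m`; apply the previous
exponent to `q` and multiply by `b`. -/
lemma ContainsFormsAbove.pow (hJ : ∀ p ∈ J, ∀ t, hcomp t p ∈ J) (hb : b.IsHomogeneous m)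
    (h : ContainsFormsAbove (J ⊔ Ideal.span {b}) (B + m)) (e : ℕ) :
    ContainsFormsAbove (J ⊔ Ideal.span {b ^ (e + 1)}) (B + (e + 1) * m) := by
  induction e with
  | zero => simpa using h
  | succ e ih =>
    intro p t ht
    push_cast at ht
    have h0 : (0 : ℤ) ≤ (e + 1) * m := by positivity
    obtain ⟨j, hj, q, hq⟩ := mem_sup_span_singleton.1 (h p t (by linarith))
    have h1 : hcomp t p = hcomp t j + hcomp (t - m) q * b := by
      conv_lhs => rw [← hcomp_hcomp, hq, map_add, hcomp_mul hb]
    obtain ⟨j', hj', u, hu⟩ := mem_sup_span_singleton.1 (ih q (t - m) (by linarith))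
    refine mem_sup_span_singleton.2 ⟨hcomp t j + j' * b,
      add_mem (hJ j hj t) (Ideal.mul_mem_right _ _ hj'), u, ?_⟩
    rw [h1, hu]; ring

/-- Write `b = j₀ + s₀ * c` with homogeneous terms. For a form `p` of degree above `B + k`, the
product `p * s₀` has degree above `B + m`, so it equals `j₁ + v * b`. Then `(p - v * c) * b ∈ J`,
and regularity of `b` gives `p - v * c ∈ J`. If `m < k`, then `b ∈ J` and regularity makes `J` the
unit ideal. -/
lemma ContainsFormsAbove.exchange (hJ : ∀ p ∈ J, ∀ t, hcomp t p ∈ J) (hb : b.IsHomogeneous m)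
    (hc : c.IsHomogeneous k) (h : ContainsFormsAbove (J ⊔ Ideal.span {b}) (B + m))
    (hbc : b ∈ J ⊔ Ideal.span {c}) (hreg : ∀ u, u * b ∈ J → u ∈ J) :
    ContainsFormsAbove (J ⊔ Ideal.span {c}) (B + k) := by
  obtain ⟨j, hj, s, hs⟩ := mem_sup_span_singleton.1 hbc
  have h1 : b = hcomp m j + hcomp (m - k) s * c := by
    rw [← hcomp_mul hc, ← map_add, ← hs, hcomp_of_isHomogeneous hb, if_pos rfl]
  have hj0 := hJ j hj m
  set j0 := hcomp (m : ℤ) j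
  intro p t ht
  rcases lt_or_ge (m : ℤ) k with hmk | hmk
  · have h2 : hcomp ((m : ℤ) - k) s = 0 := by
      rw [hcomp, if_neg (by omega)]; rfl
    rw [h2, zero_mul, add_zero] at h1
    have h3 : (1 : MvPolynomial σ K) ∈ J := hreg 1 (by rw [one_mul, h1]; exact hj0)
    rw [(Ideal.eq_top_iff_one J).2 h3]
    simp
  · have hs0 := isHomogeneous_hcomp (show (0 : ℤ) ≤ m - k by omega) s
    set s0 := hcomp ((m : ℤ) - k) s
    have h2 := h (p * s0) (t + (m - k)) (by linarith)
    rw [hcomp_mul hs0, Int.toNat_of_nonneg (by omega), add_sub_cancel_right] at h2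
    obtain ⟨j1, hj1, v, hv⟩ := mem_sup_span_singleton.1 h2
    refine mem_sup_span_singleton.2 ⟨hcomp t p - v * c, hreg _ ?_, v, by ring⟩
    have h3 : (hcomp t p - v * c) * b = hcomp t p * j0 + c * j1 := by
      linear_combination (hcomp t p) * h1 + c * hv
    rw [h3]
    exact add_mem (Ideal.mul_mem_left _ _ hj0) (Ideal.mul_mem_left _ _ hj1)

/-- If a form of positive degree is inverted by setting it to one, it was nilpotent. -/
lemma exists_pow_mem_of_one_sub_mem (hJ : ∀ p ∈ J, ∀ t, hcomp t p ∈ J) (hb : b.IsHomogeneous m)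
    (hm : 1 ≤ m) {w : MvPolynomial σ K} (hw : 1 - (1 - b) * w ∈ J) : ∃ e : ℕ, b ^ e ∈ J := by
  -- Comparing components, `w` behaves modulo `J` like the geometric series of `b`; as `w` is a
  -- polynomial, the series must stop.
  have h1 : ∀ e : ℕ, b ^ e - hcomp ((e * m : ℕ) : ℤ) w ∈ J := by
    intro e
    have h2 : ∀ t, hcomp t (1 : MvPolynomial σ K) - hcomp t w + hcomp (t - m) w * b ∈ J := by
      intro t
      have := hJ _ hw t
      rw [← hcomp_mul hb, ← map_sub, ← map_add]
      convert this using 2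
      ring
    induction e with
    | zero =>
      have := h2 0
      rw [hcomp_of_isHomogeneous (isHomogeneous_one _ _), Nat.cast_zero, if_pos rfl] at this
      have h3 : hcomp (0 - (m : ℤ)) w = 0 := by
        rw [hcomp, if_neg (by omega)]; rfl
      rw [h3, zero_mul, add_zero] at this
      simpa using this
    | succ e ih =>
      have := h2 (((e + 1) * m : ℕ) : ℤ)
      rw [hcomp_of_isHomogeneous (isHomogeneous_one _ _),
        if_neg (by exact_mod_cast (Nat.mul_pos (Nat.succ_pos e) hm).ne')] at this
      have h3 : (((e + 1) * m : ℕ) : ℤ) - m = ((e * m : ℕ) : ℤ) := by push_cast; ring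
      rw [h3] at this
      have h4 := add_mem (Ideal.mul_mem_right b _ ih) this
      convert h4 using 1
      ring
  refine ⟨w.totalDegree + 1, ?_⟩
  have h2 := h1 (w.totalDegree + 1)
  have h3 : hcomp (((w.totalDegree + 1) * m : ℕ) : ℤ) w = 0 := by
    refine (degLE_totalDegree w).hcomp_eq_zero ?_
    have : w.totalDegree < (w.totalDegree + 1) * m := by nlinarith
    exact_mod_cast this
  rwa [h3, sub_zero] at h2

end FormsAbove

/-! ### Form parameters: division, representations and exchange -/

section Parameters

variable {ι K : Type*} [Fintype ι] [Field K]

/-- Forms `h i` of positive degrees `d i`, as many as variables, that are Koszul exact and whose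
ideal contains every form of degree greater than `∑ d i - n`. -/
structure IsFormParameters (h : ι → MvPolynomial ι K) (d : ι → ℕ) : Prop where
  isHomogeneous : ∀ i, (h i).IsHomogeneous (d i)
  pos : ∀ i, 1 ≤ d i
  koszulExact : KoszulExact h
  containsForms : ContainsFormsAbove (Ideal.span (Set.range h)) (∑ i, (d i : ℤ) - Fintype.card ι)

/-- Division with remainder: every polynomial is congruent to one of degree at most
`∑ d i - n` modulo polynomials with leading forms `h i`. -/
lemma IsFormParameters.exists_reduction {h : ι → MvPolynomial ι K} {d : ι → ℕ}
    (hh : IsFormParameters h d) {g : ι → MvPolynomial ι K}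
    (hg : ∀ i, DegLE (d i - 1) (g i - h i)) (p : MvPolynomial ι K) :
    ∃ q, DegLE (∑ i, (d i : ℤ) - Fintype.card ι) q ∧ p - q ∈ Ideal.span (Set.range g) := by
  set B : ℤ := ∑ i, (d i : ℤ) - Fintype.card ι
  have main : ∀ (k : ℕ) (p : MvPolynomial ι K), DegLE (B + k) p →
      ∃ q, DegLE B q ∧ p - q ∈ Ideal.span (Set.range g) := by
    intro k
    induction k with
    | zero => exact fun p hp => ⟨p, by simpa using hp, by simp⟩
    | succ k ih =>
      intro p hp
      set t : ℤ := B + (k + 1 : ℕ) with ht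
      have h1 := hh.containsForms p t (by omega)
      obtain ⟨a, ha⟩ := Ideal.mem_span_range_iff_exists_fun.1 h1
      have h2 : hcomp t p = ∑ i, hcomp (t - d i) (a i) * h i := by
        conv_lhs => rw [← hcomp_hcomp, ← ha, map_sum]
        exact Finset.sum_congr rfl fun i _ => hcomp_mul (hh.isHomogeneous i) _ _
      obtain ⟨q, hq, hq'⟩ := ih (p - ∑ i, hcomp (t - d i) (a i) * g i) (by
        have h3 : p - ∑ i, hcomp (t - d i) (a i) * g i =
            (p - hcomp t p) - ∑ i, hcomp (t - d i) (a i) * (g i - h i) := by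
          rw [h2]
          simp only [mul_sub, Finset.sum_sub_distrib]
          ring
        rw [h3]
        refine (hp.sub_hcomp.mono (by omega)).sub (DegLE.sum _ fun i _ => ?_)
        refine ((DegLE.hcomp_self (t - d i) (a i)).mul (hg i)).mono (by omega))
      refine ⟨q, hq, ?_⟩
      have h4 : p - q = (p - ∑ i, hcomp (t - d i) (a i) * g i - q) +
        ∑ i, hcomp (t - d i) (a i) * g i := by ring
      rw [h4]
      exact add_mem hq' (Ideal.sum_mem _ fun i _ =>
        Ideal.mul_mem_left _ _ (Ideal.subset_span ⟨i, rfl⟩))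
  exact main (p.totalDegree - B).toNat p ((degLE_totalDegree p).mono (by omega))

/-- Members of the ideal of polynomials with leading forms `h i` have representations without
cancellation of leading terms. -/
lemma IsFormParameters.exists_representation [CharZero K] {h : ι → MvPolynomial ι K} {d : ι → ℕ}
    (hh : IsFormParameters h d) {g : ι → MvPolynomial ι K}
    (hg : ∀ i, DegLE (d i - 1) (g i - h i)) {p : MvPolynomial ι K} {e : ℤ} (hp : DegLE e p)
    (hpg : p ∈ Ideal.span (Set.range g)) :
    ∃ q : ι → MvPolynomial ι K, ∑ i, q i * g i = p ∧ ∀ i, DegLE (e - d i) (q i) := by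
  have main : ∀ (k : ℕ) (q : ι → MvPolynomial ι K), ∑ i, q i * g i = p →
      (∀ i, DegLE (e + k - d i) (q i)) →
      ∃ q : ι → MvPolynomial ι K, ∑ i, q i * g i = p ∧ ∀ i, DegLE (e - d i) (q i) := by
    intro k
    induction k with
    | zero => exact fun q hq hd => ⟨q, hq, by simpa using hd⟩
    | succ k ih =>
      intro q hq hd
      set t : ℤ := e + (k + 1 : ℕ) with ht
      -- The sum has degree below `t`, so the top parts of the `q i` cancel and form a syzygy of
      -- `h`.
      have h1 : ∑ i, hcomp (t - d i) (q i) * h i = 0 := by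
        have h2 : hcomp t (∑ i, q i * h i) = 0 := by
          have : ∑ i, q i * h i = p - ∑ i, q i * (g i - h i) := by
            rw [← hq]; simp only [mul_sub, Finset.sum_sub_distrib]; ring
          rw [this]
          refine DegLE.hcomp_eq_zero (e := t - 1) ((hp.mono (by omega)).sub
            (DegLE.sum _ fun i _ => ((hd i).mul (hg i)).mono (by omega))) (by omega)
        rw [map_sum] at h2
        rw [← h2]
        exact Finset.sum_congr rfl fun i _ => (hcomp_mul (hh.isHomogeneous i) _ _).symm
      obtain ⟨A, hA, hA'⟩ := hh.koszulExact _ h1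
      set A' : ι → ι → MvPolynomial ι K := fun i j => hcomp (t - d i - d j) (A i j)
      have hA1 : ∀ i j, A' i j = -A' j i := by
        intro i j
        simp only [A']
        rw [hA i j, map_neg, show t - (d i : ℤ) - d j = t - d j - d i by ring]
      have hA2 : ∀ i, hcomp (t - d i) (q i) = ∑ j, A' i j * h j := by
        intro i
        have h3 : hcomp (t - d i) (q i) = ∑ j, A i j * h j := hA' i
        rw [← hcomp_hcomp, h3, map_sum]
        exact Finset.sum_congr rfl fun j _ => hcomp_mul (hh.isHomogeneous j) _ _
      -- The antisymmetric matrix is applied to `g` instead of `h`: the represented polynomial is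
      -- unchanged, while the top parts of the coefficients cancel.
      refine ih (fun i => q i - ∑ j, A' i j * g j) ?_ fun i => ?_
      · simp only [sub_mul, Finset.sum_sub_distrib]
        rw [sum_antisymm_eq_zero hA1 g, sub_zero, hq]
      · have h3 : q i - ∑ j, A' i j * g j =
            (q i - hcomp (t - d i) (q i)) - ∑ j, A' i j * (g j - h j) := by
          rw [hA2 i]; simp only [mul_sub, Finset.sum_sub_distrib]; ring
        rw [h3]
        refine ((hd i).sub_hcomp.mono (by omega)).sub (DegLE.sum _ fun j _ => ?_)
        exact ((DegLE.hcomp_self _ _).mul (hg j)).mono (by omega)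
  obtain ⟨q, hq⟩ := Ideal.mem_span_range_iff_exists_fun.1 hpg
  refine main (∑ i, ((q i).totalDegree + d i) + (-e).toNat) q hq fun i => ?_
  refine (degLE_totalDegree (q i)).mono ?_
  have := Finset.single_le_sum (f := fun i => (q i).totalDegree + d i)
    (fun j _ => Nat.zero_le _) (Finset.mem_univ i)
  push_cast
  have h2 : ((q i).totalDegree : ℤ) + d i ≤ ∑ i, (((q i).totalDegree : ℤ) + d i) := by
    exact_mod_cast this
  omega

lemma IsFormParameters.finite_quotient {h : ι → MvPolynomial ι K} {d : ι → ℕ}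
    (hh : IsFormParameters h d) {g : ι → MvPolynomial ι K}
    (hg : ∀ i, DegLE (d i - 1) (g i - h i)) :
    Module.Finite K (MvPolynomial ι K ⧸ Ideal.span (Set.range g)) := by
  let φ : restrictTotalDegree ι K (∑ i, d i) →ₗ[K] MvPolynomial ι K ⧸ Ideal.span (Set.range g) :=
    (Ideal.Quotient.mkₐ K (Ideal.span (Set.range g))).toLinearMap ∘ₗ Submodule.subtype _
  refine Module.Finite.of_surjective φ fun x => ?_
  obtain ⟨p, rfl⟩ := Ideal.Quotient.mk_surjective x
  obtain ⟨q, hq, hpq⟩ := hh.exists_reduction hg p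
  refine ⟨⟨q, ?_⟩, ?_⟩
  · rw [mem_restrictTotalDegree, ← degLE_natCast_iff]
    exact hq.mono (by push_cast; omega)
  · exact (Ideal.Quotient.eq.2 hpq).symm

variable [DecidableEq ι] [CharZero K]

/-- The exchange theorem for form parameters. -/
theorem IsFormParameters.update {h : ι → MvPolynomial ι K} {d : ι → ℕ}
    (hh : IsFormParameters h d) (i : ι) {c : MvPolynomial ι K} {m : ℕ} (hc : c.IsHomogeneous m)
    (hm : 1 ≤ m) {e : ℕ}
    (he : h i ^ e ∈ Ideal.span (Set.range (Function.update h i c))) :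
    IsFormParameters (Function.update h i c) (Function.update d i m) := by
  have he1 : h i ^ (e + 1) ∈ Ideal.span (Set.range (Function.update h i c)) := by
    rw [pow_succ]; exact Ideal.mul_mem_right _ _ he
  refine ⟨fun j => ?_, fun j => ?_, hh.koszulExact.update i he, ?_⟩
  · by_cases hj : j = i
    · subst hj; simpa using hc
    · simpa [hj] using hh.isHomogeneous j
  · by_cases hj : j = i
    · subst hj; simpa using hm
    · simpa [hj] using hh.pos j
  · have hJ : ∀ p ∈ Ideal.span (h '' {i}ᶜ), ∀ t, hcomp t p ∈ Ideal.span (h '' {i}ᶜ) := by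
      intro p hp t
      refine hcomp_mem_span ?_ hp t
      rintro _ ⟨j, _, rfl⟩
      exact ⟨_, hh.isHomogeneous j⟩
    set B : ℤ := ∑ j ∈ Finset.univ.erase i, (d j : ℤ) - Fintype.card ι with hB
    have hs1 : ∑ j, (d j : ℤ) - Fintype.card ι = B + d i := by
      rw [← Finset.sum_erase_add _ _ (Finset.mem_univ i), hB]; ring
    have hs2 : ∑ j, (Function.update d i m j : ℤ) - Fintype.card ι = B + m := by
      rw [← Finset.sum_erase_add _ _ (Finset.mem_univ i), hB, Function.update_self]
      rw [Finset.sum_congr rfl fun j hj => by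
        rw [Function.update_of_ne (Finset.ne_of_mem_erase hj)]]
      ring
    have h1 := hh.containsForms
    rw [hs1, span_range_eq_sup h i] at h1
    have h2 := h1.pow hJ (hh.isHomogeneous i) e
    rw [hs2, span_range_update]
    rw [span_range_update] at he1
    refine ContainsFormsAbove.exchange hJ ((hh.isHomogeneous i).pow (e + 1)) hc ?_ he1
      (fun u hu => hh.koszulExact.mem_of_mul_pow_mem i _ hu)
    convert h2 using 2
    push_cast; ring

/-- Powers of the variables are form parameters. -/
lemma isFormParameters_X_pow (N : ι → ℕ) (hN : ∀ i, 1 ≤ N i) :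
    IsFormParameters (fun i => (X i : MvPolynomial ι K) ^ N i) N := by
  have hspan : ∀ s : Set ι, Ideal.span ((fun i => (X i : MvPolynomial ι K) ^ N i) '' s) =
      Ideal.span ((fun m => monomial m (1 : K)) '' ((fun i => Finsupp.single i (N i)) '' s)) := by
    intro s
    rw [Set.image_image]
    simp only [X_pow_eq_monomial]
  refine ⟨fun i => isHomogeneous_X_pow i (N i), hN, ?_, ?_⟩
  · refine koszulExact_of_regular fun s i hi u hu => ?_
    rw [hspan, mem_ideal_span_monomial_image] at hu ⊢
    intro m hm
    obtain ⟨_, ⟨j, hj, rfl⟩, hle⟩ := hu (m + Finsupp.single i (N i)) (by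
      rw [mem_support_iff, X_pow_eq_monomial, coeff_mul_monomial, mul_one]
      exact mem_support_iff.1 hm)
    refine ⟨_, ⟨j, hj, rfl⟩, ?_⟩
    have hij : i ≠ j := fun h' => hi (h' ▸ hj)
    have := hle j
    rw [Finsupp.single_le_iff]
    simpa [Finsupp.single_eq_of_ne hij.symm] using this
  · intro p t ht
    rw [← Set.image_univ, hspan, mem_ideal_span_monomial_image]
    intro m hm
    rw [mem_support_iff, coeff_hcomp] at hm
    have hmt : (m.degree : ℤ) = t := by
      by_contra h'
      exact hm (if_neg h')
    by_contra hcon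
    push Not at hcon
    -- A monomial outside the ideal has each exponent at most `N i - 1`; this is the source of the
    -- bound `∑ d i - n`.
    have h1 : ∀ i, m i + 1 ≤ N i := by
      intro i
      have := hcon (Finsupp.single i (N i)) ⟨i, Set.mem_univ _, rfl⟩
      rw [Finsupp.single_le_iff] at this
      omega
    have h2 : ∑ i, (m i + 1) ≤ ∑ i, N i := Finset.sum_le_sum fun i _ => h1 i
    rw [Finset.sum_add_distrib, ← Finsupp.degree_eq_sum] at h2
    simp only [Finset.sum_const, Finset.card_univ, smul_eq_mul, mul_one] at h2
    have h3 : (m.degree : ℤ) + Fintype.card ι ≤ ∑ i, (N i : ℤ) := by exact_mod_cast h2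
    omega

end Parameters

/-! ### Generic linear combinations and Macaulay's theorem -/

section Generic

/-- In a finite-dimensional algebra over an infinite field, a generic linear combination of
generators of the unit ideal is a unit. -/
lemma exists_isUnit_sum_smul {ι K A : Type*} [Fintype ι] [DecidableEq ι] [Field K] [Infinite K]
    [CommRing A] [Algebra K A] [Module.Finite K A] {H : ι → A}
    (hH : Ideal.span (Set.range H) = ⊤) : ∃ t : ι → K, IsUnit (∑ i, t i • H i) := by
  have : IsArtinianRing A := isArtinian_of_tower K inferInstance
  by_contra! hcon
  let p : MaximalSpectrum A → Submodule K (ι → K) := fun M =>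
    (M.asIdeal.restrictScalars K).comap (Fintype.linearCombination K H)
  have hp : ∀ M t, t ∈ p M ↔ ∑ i, t i • H i ∈ M.asIdeal := fun M t => by
    simp [p, Fintype.linearCombination_apply]
  -- There are finitely many maximal ideals, and a vector space over an infinite field is not a
  -- finite union of proper subspaces.
  obtain ⟨M, hM⟩ := Subspace.exists_eq_top_of_iUnion_eq_univ (p := p) (by
    rw [Set.eq_univ_iff_forall]
    intro t
    obtain ⟨M, hM, hM'⟩ := exists_max_ideal_of_mem_nonunits (hcon t)
    exact Set.mem_iUnion.2 ⟨⟨M, hM⟩, (hp _ _).2 hM'⟩)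
  refine M.isMaximal.ne_top (top_le_iff.1 ?_)
  rw [← hH, Ideal.span_le]
  rintro _ ⟨i, rfl⟩
  have h1 : Pi.single i (1 : K) ∈ p M := by rw [hM]; trivial
  rw [hp] at h1
  simpa [Pi.single_apply, ite_smul] using h1

variable {ι K : Type*} [Fintype ι] [Field K] [DecidableEq ι] [CharZero K]

/-- If `h i` lies in the ideal of forms `H j` of the same degree, then `h i` can be exchanged for a
linear combination of the `H j`. -/
lemma IsFormParameters.exists_generic {h : ι → MvPolynomial ι K} {d : ι → ℕ}
    (hh : IsFormParameters h d) (i : ι) {H : ι → MvPolynomial ι K} {D : ℕ}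
    (hH : ∀ j, (H j).IsHomogeneous D) (hi : h i ∈ Ideal.span (Set.range H)) :
    ∃ (t : ι → K) (e : ℕ),
      h i ^ e ∈ Ideal.span (Set.range (Function.update h i (∑ j, t j • H j))) := by
  -- Setting `h i = 1` keeps the leading forms, so the quotient is finite-dimensional, and there the
  -- `H j` generate the unit ideal.
  set g := Function.update h i (h i - 1) with hg
  have hgh : ∀ j, DegLE (d j - 1) (g j - h j) := by
    intro j
    by_cases hj : j = i
    · subst hj
      rw [hg, Function.update_self, sub_sub_cancel_left]
      have h1 := (DegLE.of_isHomogeneous (isHomogeneous_one ι K)).neg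
      have h2 := hh.pos j
      exact h1.mono (by push_cast; omega)
    · rw [hg, Function.update_of_ne hj, sub_self]
      exact DegLE.zero _
  have := hh.finite_quotient hgh
  set I := Ideal.span (Set.range g) with hI
  have hi1 : Ideal.Quotient.mk I (h i) = 1 := by
    rw [← map_one (Ideal.Quotient.mk I), Ideal.Quotient.eq]
    exact Ideal.subset_span ⟨i, by rw [hg, Function.update_self]⟩
  obtain ⟨t, ht⟩ := exists_isUnit_sum_smul (K := K) (H := fun j => Ideal.Quotient.mk I (H j)) (by
    rw [Ideal.eq_top_iff_one, ← hi1]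
    have h1 := Ideal.mem_map_of_mem (Ideal.Quotient.mk I) hi
    rwa [Ideal.map_span, ← Set.range_comp] at h1)
  refine ⟨t, ?_⟩
  set v := ∑ j, t j • H j with hv
  have hvmk : ∑ j, t j • Ideal.Quotient.mk I (H j) = Ideal.Quotient.mk I v := by
    have : ∀ x, Ideal.Quotient.mk I x = Ideal.Quotient.mkₐ K I x := fun _ => rfl
    simp only [this, hv, map_sum, map_smul]
  rw [hvmk] at ht
  obtain ⟨y, hy⟩ := ht.exists_right_inv
  obtain ⟨w, rfl⟩ := Ideal.Quotient.mk_surjective y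
  rw [← map_mul, ← map_one (Ideal.Quotient.mk I), Ideal.Quotient.eq, hI, hg,
    span_range_update] at hy
  obtain ⟨j, hj, u, hu⟩ := mem_sup_span_singleton.1 hy
  rw [span_range_update]
  refine exists_pow_mem_of_one_sub_mem (w := u) (fun p hp e => ?_) (hh.isHomogeneous i)
    (hh.pos i) (mem_sup_span_singleton.2 ⟨-j, neg_mem hj, w, ?_⟩)
  · rw [← Ideal.span_union] at hp ⊢
    refine hcomp_mem_span ?_ hp e
    rintro x (⟨k, _, rfl⟩ | rfl)
    · exact ⟨_, hh.isHomogeneous k⟩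
    · refine ⟨D, IsHomogeneous.sum _ _ _ fun k _ => ?_⟩
      rw [smul_eq_C_mul]
      exact (hH k).C_mul _
  · linear_combination (-1 : MvPolynomial ι K) * hu

/-- Forms of the same positive degree, as many as variables, whose ideal contains powers of all
variables. -/
lemma isFormParameters_of_pow_mem_of_degree_eq {H : ι → MvPolynomial ι K} {D : ℕ} (hD : 1 ≤ D)
    (hH : ∀ j, (H j).IsHomogeneous D)
    (hX : ∀ i, ∃ N : ℕ, (X i : MvPolynomial ι K) ^ N ∈ Ideal.span (Set.range H)) :
    IsFormParameters H (fun _ => D) := by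
  choose N hN using hX
  have hlin : ∀ t : ι → K, (∑ j, t j • H j).IsHomogeneous D := fun t =>
    IsHomogeneous.sum _ _ _ fun k _ => by
      rw [smul_eq_C_mul]
      exact (hH k).C_mul _
  have main : ∀ s : Finset ι, ∃ (k : ι → MvPolynomial ι K) (δ : ι → ℕ), IsFormParameters k δ ∧
      ∀ i, (i ∈ s → δ i = D ∧ ∃ t : ι → K, k i = ∑ j, t j • H j) ∧
        (i ∉ s → k i ∈ Ideal.span (Set.range H)) := by
    intro s
    induction s using Finset.induction_on with
    | empty =>
      refine ⟨_, _, isFormParameters_X_pow (fun i => N i + 1) (fun i => Nat.le_add_left _ _),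
        fun i => ⟨by simp, fun _ => ?_⟩⟩
      simp only [pow_succ]
      exact Ideal.mul_mem_right _ _ (hN i)
    | insert i s hi ih =>
      obtain ⟨k, δ, hk, hks⟩ := ih
      obtain ⟨t, e, he⟩ := hk.exists_generic i hH ((hks i).2 hi)
      refine ⟨_, _, hk.update i (hlin t) hD he, fun j => ?_⟩
      by_cases hj : j = i
      · subst hj
        simp only [Function.update_self]
        exact ⟨fun _ => ⟨trivial, t, rfl⟩, fun h' => absurd (Finset.mem_insert_self _ _) h'⟩
      · simp only [Function.update_of_ne hj, Finset.mem_insert, hj, false_or]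
        exact hks j
  obtain ⟨k, δ, hk, hks⟩ := main Finset.univ
  have hδ : δ = fun _ => D := funext fun i => ((hks i).1 (Finset.mem_univ i)).1
  subst hδ
  choose T hT using fun i => ((hks i).1 (Finset.mem_univ i)).2
  have hk0 : ∀ j, constantCoeff (k j) = 0 := fun j =>
    (hk.isHomogeneous j).coeff_eq_zero (by
      rw [map_zero]; exact Nat.ne_of_lt hD)
  -- A constant linear relation among the `k i` would be a Koszul syzygy, whose entries have zero
  -- constant term.
  have hdet : (Matrix.of T).det ≠ 0 := by
    intro h0
    obtain ⟨v, hv, hv'⟩ := Matrix.exists_vecMul_eq_zero_iff.2 h0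
    have h1 : ∑ i, C (v i) * k i = 0 := by
      simp only [hT, Finset.mul_sum, ← smul_eq_C_mul, smul_smul]
      rw [Finset.sum_comm]
      refine Finset.sum_eq_zero fun j _ => ?_
      rw [← Finset.sum_smul]
      have : ∑ i, v i * T i j = 0 := congrFun hv' j
      rw [this, zero_smul]
    obtain ⟨A, _, hA'⟩ := hk.koszulExact _ h1
    apply hv
    funext i
    have h2 := congrArg constantCoeff (hA' i)
    simpa [hk0] using h2
  refine ⟨hH, fun _ => hD, ?_, fun p t ht => ?_⟩
  · have hU : ((Matrix.of T)⁻¹.map (C : K →+* MvPolynomial ι K)) *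
        ((Matrix.of T).map (C : K →+* MvPolynomial ι K)) = 1 := by
      rw [← Matrix.map_mul, Matrix.nonsing_inv_mul _ hdet.isUnit]
      exact Matrix.map_one _ (map_zero _) (map_one _)
    refine KoszulExact.of_matrix hU (fun i => ?_) hk.koszulExact
    rw [hT i]
    simp [smul_eq_C_mul]
  · refine Ideal.span_le.2 ?_ (hk.containsForms p t ht)
    rintro _ ⟨i, rfl⟩
    rw [hT i]
    refine Ideal.sum_mem _ fun j _ => ?_
    rw [smul_eq_C_mul]
    exact Ideal.mul_mem_left _ _ (Ideal.subset_span ⟨j, rfl⟩)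

/-- Forms of positive degrees, as many as variables, whose ideal contains powers of all
variables, are form parameters: they are Koszul exact and satisfy Macaulay's degree bound. -/
theorem isFormParameters_of_pow_mem {h : ι → MvPolynomial ι K} {d : ι → ℕ} (hd : ∀ i, 1 ≤ d i)
    (hh : ∀ i, (h i).IsHomogeneous (d i))
    (hX : ∀ i, ∃ N : ℕ, (X i : MvPolynomial ι K) ^ N ∈ Ideal.span (Set.range h)) :
    IsFormParameters h d := by
  -- With these exponents every `h i ^ a i` has degree `∏ d j`.
  set a : ι → ℕ := fun i => ∏ j ∈ Finset.univ.erase i, d j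
  have ha : ∀ i, d i * a i = ∏ j, d j := fun i => Finset.mul_prod_erase _ _ (Finset.mem_univ i)
  have hD : 1 ≤ ∏ j, d j := Finset.one_le_prod' fun i _ => hd i
  set H : ι → MvPolynomial ι K := fun i => h i ^ a i
  have h0 : IsFormParameters H (fun _ => ∏ j, d j) := by
    refine isFormParameters_of_pow_mem_of_degree_eq hD (fun j => ?_) fun i => ?_
    · rw [← ha j]; exact (hh j).pow _
    · have h1 : Ideal.span (Set.range h) ≤ (Ideal.span (Set.range H)).radical := by
        rw [Ideal.span_le]
        rintro _ ⟨j, rfl⟩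
        exact ⟨a j, Ideal.subset_span ⟨j, rfl⟩⟩
      obtain ⟨N, hN⟩ := hX i
      obtain ⟨M, hM⟩ := h1 hN
      exact ⟨N * M, by rwa [pow_mul]⟩
  have main : ∀ s : Finset ι,
      IsFormParameters (s.piecewise h H) (s.piecewise d (fun _ => ∏ j, d j)) := by
    intro s
    induction s using Finset.induction_on with
    | empty => simpa using h0
    | insert i s hi ih =>
      rw [Finset.piecewise_insert, Finset.piecewise_insert]
      refine ih.update i (hh i) (hd i) (e := 1) ?_
      rw [pow_one, Finset.piecewise_eq_of_notMem _ _ _ hi]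
      have hmem : h i ∈ Ideal.span (Set.range (Function.update (s.piecewise h H) i (h i))) :=
        Ideal.subset_span ⟨i, Function.update_self _ _ _⟩
      refine Ideal.pow_mem_of_mem _ hmem _ (Nat.pos_of_ne_zero fun h' => ?_)
      have := ha i
      rw [h'] at this
      omega
  simpa using main Finset.univ

end Generic

/-! ### Sums of two squares in finite-dimensional real algebras -/

section SumsOfSquares

/-- The field is `ℝ` or `ℂ`. The condition `a ≠ 0` is what permits lifting modulo nilpotents later;
over `ℂ` it is secured by taking `a = 1`. -/
lemma exists_sq_add_sq_of_field {F : Type*} [Field F] [Algebra ℝ F] [Algebra.IsAlgebraic ℝ F]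
    (p : F) (hp : ∀ φ : F →ₐ[ℝ] ℝ, 0 < φ p) : ∃ a b : F, a ≠ 0 ∧ p = a ^ 2 + b ^ 2 := by
  rcases Real.nonempty_algEquiv_or F with ⟨⟨e⟩⟩ | ⟨⟨e⟩⟩
  · have h1 : 0 < e p := hp e.toAlgHom
    refine ⟨e.symm (Real.sqrt (e p)), 0, ?_, e.injective ?_⟩
    · rw [Ne, EmbeddingLike.map_eq_zero_iff]
      exact (Real.sqrt_pos.2 h1).ne'
    · simp [Real.sq_sqrt h1.le]
  · obtain ⟨z, hz⟩ := IsAlgClosed.exists_pow_nat_eq (e p - 1) (n := 2) (by norm_num)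
    refine ⟨1, e.symm z, one_ne_zero, e.injective ?_⟩
    simp [hz]

/-- An element of a finite-dimensional real algebra that is positive at all real points is a sum
of two squares. -/
theorem exists_sq_add_sq {A : Type*} [CommRing A] [Algebra ℝ A] [Module.Finite ℝ A] (p : A)
    (hp : ∀ φ : A →ₐ[ℝ] ℝ, 0 < φ p) : ∃ a b : A, p = a ^ 2 + b ^ 2 := by
  have : IsArtinianRing A := isArtinian_of_tower ℝ inferInstance
  have h1 : ∀ M : MaximalSpectrum A, ∃ a b : A, a ∉ M.asIdeal ∧
      p - (a ^ 2 + b ^ 2) ∈ M.asIdeal := by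
    intro M
    let _ : Field (A ⧸ M.asIdeal) := Ideal.Quotient.field M.asIdeal
    have : Module.Finite ℝ (A ⧸ M.asIdeal) :=
      Module.Finite.of_surjective (Ideal.Quotient.mkₐ ℝ M.asIdeal).toLinearMap
        Ideal.Quotient.mk_surjective
    obtain ⟨a, b, ha, hab⟩ := exists_sq_add_sq_of_field (Ideal.Quotient.mk M.asIdeal p)
      (fun φ => hp (φ.comp (Ideal.Quotient.mkₐ ℝ M.asIdeal)))
    obtain ⟨a, rfl⟩ := Ideal.Quotient.mk_surjective a
    obtain ⟨b, rfl⟩ := Ideal.Quotient.mk_surjective b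
    refine ⟨a, b, fun h => ha (Ideal.Quotient.eq_zero_iff_mem.2 h), ?_⟩
    rw [← Ideal.Quotient.eq, hab]
    simp
  choose a b ha hab using h1
  have hcop : Pairwise (Function.onFun IsCoprime fun M : MaximalSpectrum A => M.asIdeal) :=
    fun I J hIJ => I.isCoprime_of_ne hIJ
  obtain ⟨x, hx⟩ := Ideal.exists_forall_sub_mem_ideal hcop a
  obtain ⟨y, hy⟩ := Ideal.exists_forall_sub_mem_ideal hcop b
  have hxu : IsUnit x := by
    by_contra h
    obtain ⟨M, hM, hxM⟩ := exists_max_ideal_of_mem_nonunits h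
    refine ha ⟨M, hM⟩ ?_
    have := sub_mem hxM (hx ⟨M, hM⟩)
    rwa [sub_sub_cancel] at this
  have hnil : IsNilpotent (x ^ 2 - (p - y ^ 2)) := by
    rw [← mem_nilradical, IsArtinianRing.nilradical_eq_iInf, Ideal.mem_iInf]
    intro M
    rw [← Ideal.Quotient.eq_zero_iff_mem]
    have h1 := Ideal.Quotient.eq_zero_iff_mem.2 (hab M)
    have h2 := Ideal.Quotient.eq.2 (hx M)
    have h3 := Ideal.Quotient.eq.2 (hy M)
    simp only [map_sub, map_add, map_pow] at h1 ⊢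
    rw [h2, h3]
    linear_combination -h1
  obtain ⟨z, hz⟩ : ∃ z, z = p - y ^ 2 := ⟨_, rfl⟩
  rw [← hz] at hnil
  -- Newton's method lifts the square root `x` of `z` from the reduced quotient; the derivative `2 *
  -- x` is a unit.
  obtain ⟨r, ⟨-, hr⟩, -⟩ := Polynomial.existsUnique_nilpotent_sub_and_aeval_eq_zero
    (P := (Polynomial.X ^ 2 - Polynomial.C z : Polynomial A)) (x := x)
    (by simpa using hnil) (by
      have h2 : IsUnit (2 : A) := by
        have := (IsUnit.mk0 (2 : ℝ) two_ne_zero).map (algebraMap ℝ A)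
        rwa [map_ofNat] at this
      simpa [one_add_one_eq_two] using h2.mul hxu)
  refine ⟨r, y, ?_⟩
  simp only [map_sub, map_pow, Polynomial.aeval_X, Polynomial.aeval_C, Algebra.algebraMap_self,
    RingHom.id_apply] at hr
  linear_combination -hz - hr

end SumsOfSquares

/-! ### Exactness of the relaxation -/

section Relaxation

variable {n : ℕ} {f : MvPolynomial (Fin n) ℝ} {g : Fin n → MvPolynomial (Fin n) ℝ}

lemma eval_nonneg_of_isSumSq {p : MvPolynomial (Fin n) ℝ} (hp : IsSumSq p) (x : Fin n → ℝ) :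
    0 ≤ eval x p := by
  induction hp with
  | zero => simp
  | sq_add a _ ih => rw [map_add, map_mul]; exact add_nonneg (mul_self_nonneg _) ih

lemma relaxationValue_le_optValue (d : ℕ) : relaxationValue f g d ≤ optValue f g := by
  refine iSup₂_le fun c hc => le_iInf₂ fun x hx => ?_
  obtain ⟨q, σ, h, -, -, hσ⟩ := hc
  have h1 := congrArg (eval x) h
  simp only [map_sub, eval_C, map_add, map_sum, map_mul] at h1
  rw [Finset.sum_eq_zero fun i _ => by rw [hx i, mul_zero], zero_add] at h1
  have h2 := eval_nonneg_of_isSumSq hσ x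
  exact EReal.coe_le_coe_iff.2 (by linarith)

/-- Strict inequality suffices for a supremum, and it is what makes `f - c` strictly positive on the
feasible set. -/
lemma relaxationValue_eq_optValue {d : ℕ}
    (h : ∀ c : ℝ, (c : EReal) < optValue f g → RelaxationFeasible f g d c) :
    relaxationValue f g d = optValue f g := by
  refine le_antisymm (relaxationValue_le_optValue d) ?_
  rw [← EReal.ge_of_forall_gt_iff_ge]
  exact fun c hc => le_iSup₂_of_le c (h c hc) le_rfl

/-- If some constraint is a nonzero constant, every order at least `deg f / 2` is exact. -/
lemma relaxationFeasible_of_constant {i : Fin n} (hi : (g i).totalDegree = 0) (hgi : g i ≠ 0)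
    {d : ℕ} (hd : f.totalDegree ≤ 2 * d) (c : ℝ) : RelaxationFeasible f g d c := by
  obtain ⟨r, hr⟩ : ∃ r, g i = C r := ⟨_, totalDegree_eq_zero_iff_eq_C.1 hi⟩
  have hr0 : r ≠ 0 := by rintro rfl; exact hgi (by rw [hr, C_0])
  have hmul : C r⁻¹ * (f - C c) * g i = f - C c := by
    rw [hr, mul_right_comm, ← C_mul, inv_mul_cancel₀ hr0, C_1, one_mul]
  refine ⟨Pi.single i (C r⁻¹ * (f - C c)), 0, ?_, fun j => ?_, by simp, IsSumSq.zero⟩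
  · rw [Finset.sum_eq_single i (fun j _ hj => by rw [Pi.single_eq_of_ne hj, zero_mul]) (by simp),
      Pi.single_eq_same, hmul, add_zero]
  · by_cases hj : j = i
    · subst hj
      rw [Pi.single_eq_same, hmul]
      exact (totalDegree_sub_C_le _ _).trans hd
    · rw [Pi.single_eq_of_ne hj, zero_mul, totalDegree_zero]
      exact Nat.zero_le _

lemma isFormParameters_topForm (hg : NoZeroAtInfinity g)
    (hc : ∀ i, (g i).totalDegree = 0 → g i = 0) :
    IsFormParameters (fun i => topForm (g i)) (fun i => (g i).totalDegree) := by
  -- A zero constraint gets the provisional degree `1`, as form parameters need positive degrees;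
  -- Koszul exactness then excludes zero constraints.
  set d : Fin n → ℕ := fun i => if g i = 0 then 1 else (g i).totalDegree with hd
  have key : IsFormParameters (fun i => topForm (g i)) d := by
    refine isFormParameters_of_pow_mem (fun i => ?_) (fun i => ?_) fun i => ?_
    · simp only [hd]
      split_ifs with h
      · exact le_rfl
      · exact Nat.pos_of_ne_zero fun h' => h (hc i h')
    · simp only [hd]
      split_ifs with h
      · simp only [h, topForm, map_zero]
        exact isHomogeneous_zero _ _ _
      · exact homogeneousComponent_isHomogeneous _ _
    · have h1 : (X i : MvPolynomial (Fin n) ℝ) ∈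
          (Ideal.span (Set.range fun i => topForm (g i))).radical := by
        rw [← vanishingIdeal_zeroLocus_eq_radical (K := ℂ), mem_vanishingIdeal_iff]
        intro z hz
        have hz0 : z = 0 := by
          by_contra h0
          exact hg ⟨z, h0, fun j => hz _ (Ideal.subset_span ⟨j, rfl⟩)⟩
        simp [hz0]
      exact h1
  have hne : ∀ i, g i ≠ 0 := by
    intro i hi
    have h0 : topForm (g i) = 0 := by simp [hi, topForm]
    obtain ⟨A, -, hA⟩ := key.koszulExact (Pi.single i 1) (by simp [Pi.single_apply, h0])
    have h1 := congrArg constantCoeff (hA i)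
    have h2 : ∀ j, constantCoeff (topForm (g j)) = 0 := fun j =>
      (key.isHomogeneous j).coeff_eq_zero (by
        rw [map_zero]; exact Nat.ne_of_lt (key.pos j))
    simp [h2] at h1
  have hdd : d = fun i => (g i).totalDegree := funext fun i => if_neg (hne i)
  rwa [hdd] at key

lemma degLE_sub_topForm (p : MvPolynomial (Fin n) ℝ) :
    DegLE ((p.totalDegree : ℤ) - 1) (p - topForm p) := by
  rw [topForm, ← hcomp_natCast]
  exact (degLE_totalDegree p).sub_hcomp

/-- Real points of the quotient are evaluations at feasible points, so `f - c` is a sum of two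
squares there. Reducing both elements to degree at most `d` bounds `σ` by `2 * d`, and a
representation without cancellation bounds the multiplier terms. -/
lemma relaxationFeasible_of_lt {e : Fin n → ℕ}
    (hh : IsFormParameters (fun i => topForm (g i)) e) (he : ∀ i, e i = (g i).totalDegree)
    {d : ℕ} (hf : f.totalDegree ≤ 2 * d) (hd : ∑ i, (e i : ℤ) - n ≤ d) {c : ℝ}
    (hc : (c : EReal) < optValue f g) : RelaxationFeasible f g d c := by
  have hg : ∀ i, DegLE ((e i : ℤ) - 1) (g i - topForm (g i)) := fun i => by
    rw [he]; exact degLE_sub_topForm _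
  have hfin := hh.finite_quotient hg
  set I := Ideal.span (Set.range g) with hI
  obtain ⟨a, b, hab⟩ := exists_sq_add_sq (Ideal.Quotient.mk I (f - C c)) (fun φ => by
    set ψ := φ.comp (Ideal.Quotient.mkₐ ℝ I)
    set x : Fin n → ℝ := fun i => ψ (X i)
    have hψ : ψ = aeval x := by ext i; simp [x]
    have hx : x ∈ feasibleSet g := by
      intro i
      have h1 : ψ (g i) = 0 := by
        have : Ideal.Quotient.mk I (g i) = 0 :=
          Ideal.Quotient.eq_zero_iff_mem.2 (Ideal.subset_span ⟨i, rfl⟩)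
        simp [ψ, this]
      rwa [hψ, aeval_eq_eval] at h1
    have h2 : φ (Ideal.Quotient.mk I (f - C c)) = eval x (f - C c) := by
      change ψ (f - C c) = _
      rw [hψ, aeval_eq_eval]
    rw [h2, map_sub, eval_C, sub_pos]
    exact EReal.coe_lt_coe_iff.1 (hc.trans_le (iInf₂_le x hx)))
  obtain ⟨a, rfl⟩ := Ideal.Quotient.mk_surjective a
  obtain ⟨b, rfl⟩ := Ideal.Quotient.mk_surjective b
  obtain ⟨r, hr, har⟩ := hh.exists_reduction hg a
  obtain ⟨s, hs, hbs⟩ := hh.exists_reduction hg b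
  rw [Ideal.Quotient.eq.2 har, Ideal.Quotient.eq.2 hbs, ← map_pow, ← map_pow, ← map_add,
    Ideal.Quotient.eq] at hab
  rw [Fintype.card_fin] at hr hs
  have hσ : DegLE ((2 * d : ℕ) : ℤ) (r ^ 2 + s ^ 2) := by
    rw [pow_two, pow_two]
    exact ((hr.mul hr).mono (by push_cast; omega)).add ((hs.mul hs).mono (by push_cast; omega))
  have hfc : DegLE ((2 * d : ℕ) : ℤ) (f - C c) :=
    degLE_natCast_iff.2 ((totalDegree_sub_C_le _ _).trans hf)
  obtain ⟨q, hq, hqd⟩ := hh.exists_representation hg (hfc.sub hσ) hab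
  refine ⟨q, r ^ 2 + s ^ 2, by rw [hq]; ring, fun i => ?_, degLE_natCast_iff.1 hσ, ?_⟩
  · rw [← degLE_natCast_iff]
    have := (hqd i).mul (degLE_totalDegree (g i))
    rwa [he, sub_add_cancel] at this
  · rw [pow_two, pow_two]
    exact (IsSumSq.mul_self r).add (IsSumSq.mul_self s)

/-- The relaxation of order `⌈max (∑ deg gᵢ - n, deg f / 2)⌉` is exact. -/
theorem relaxationValue_toNat_degreeBound (hg : NoZeroAtInfinity g) :
    relaxationValue f g (degreeBound f g).toNat = optValue f g := by
  have h1 : ((f.totalDegree : ℝ) / 2) ≤ degreeBound f g :=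
    (le_max_right _ _).trans (Int.le_ceil _)
  have h2 : (∑ i, ((g i).totalDegree : ℝ)) - (n : ℝ) ≤ degreeBound f g :=
    (le_max_left _ _).trans (Int.le_ceil _)
  have h3 : (f.totalDegree : ℤ) ≤ 2 * degreeBound f g := by
    have : (f.totalDegree : ℝ) ≤ 2 * degreeBound f g := by linarith
    exact_mod_cast this
  have h4 : ∑ i, ((g i).totalDegree : ℤ) - n ≤ degreeBound f g := by exact_mod_cast h2
  have h5 : f.totalDegree ≤ 2 * (degreeBound f g).toNat := by omega
  refine relaxationValue_eq_optValue fun c hc => ?_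
  by_cases hcon : ∀ i, (g i).totalDegree = 0 → g i = 0
  · exact relaxationFeasible_of_lt (isFormParameters_topForm hg hcon) (fun _ => rfl) h5
      (by omega) hc
  · push Not at hcon
    obtain ⟨i, hi, hgi⟩ := hcon
    exact relaxationFeasible_of_constant hi hgi h5 c

lemma degreeBound_nonneg (f : MvPolynomial (Fin n) ℝ) (g : Fin n → MvPolynomial (Fin n) ℝ) :
    0 ≤ degreeBound f g :=
  Int.ceil_nonneg (le_max_of_le_right (by positivity))

/-- All summands `deg (g i) - 1` are nonnegative, so each is at most the bound `D`; once `D ≥ 1`,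
`deg (g i) ≤ D + 1 ≤ 2 * D`. -/
lemma admissibleOrder_toNat_degreeBound (h1 : ∀ i, 1 ≤ (g i).totalDegree)
    (h2 : 1 ≤ f.totalDegree ∨ ∃ i, 2 ≤ (g i).totalDegree) :
    AdmissibleOrder g (degreeBound f g).toNat := by
  have hsum : ∀ i, ((g i).totalDegree : ℤ) - 1 ≤ degreeBound f g := by
    intro i
    have h3 : (∑ i, ((g i).totalDegree : ℝ)) - (n : ℝ) ≤ degreeBound f g :=
      (le_max_left _ _).trans (Int.le_ceil _)
    have h4 : ∑ i, ((g i).totalDegree : ℤ) - n ≤ degreeBound f g := by exact_mod_cast h3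
    have h5 : ∑ i, (((g i).totalDegree : ℤ) - 1) = ∑ i, ((g i).totalDegree : ℤ) - n := by
      simp [Finset.sum_sub_distrib]
    have h6 := Finset.single_le_sum (f := fun i => ((g i).totalDegree : ℤ) - 1)
      (fun j _ => by have := h1 j; omega) (Finset.mem_univ i)
    omega
  have hpos : 1 ≤ degreeBound f g := by
    rcases h2 with h2 | ⟨i, hi⟩
    · have h3 : (0 : ℝ) < f.totalDegree / 2 := by
        have : (1 : ℝ) ≤ f.totalDegree := by exact_mod_cast h2
        linarith
      exact Int.one_le_ceil_iff.2 (lt_max_of_lt_right h3)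
    · have := hsum i
      omega
  refine ⟨by omega, fun i => ?_⟩
  have := hsum i
  omega

end Relaxation

/-! ### The double point: exact but unattained -/

section Unattained

lemma eval_pderiv_eq_zero_of_isSumSq {n : ℕ} {p : MvPolynomial (Fin n) ℝ} (hp : IsSumSq p)
    (x : Fin n → ℝ) (hx : eval x p = 0) (i : Fin n) : eval x (pderiv i p) = 0 := by
  induction hp with
  | zero => simp
  | sq_add a hs ih =>
    rw [map_add, map_mul] at hx
    have h1 := eval_nonneg_of_isSumSq hs x
    have h2 := mul_self_nonneg (eval x a)
    have h3 : eval x a = 0 := mul_self_eq_zero.1 (by linarith)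
    rw [map_add, map_add, ih (by linarith)]
    simp [Derivation.leibniz, h3]

lemma feasibleSet_X_sq :
    feasibleSet (fun _ => X 0 ^ 2 : Fin 1 → MvPolynomial (Fin 1) ℝ) = {0} := by
  ext x
  simp only [feasibleSet, Set.mem_ofPred_eq, map_pow, eval_X, Set.mem_singleton_iff]
  constructor
  · intro h
    funext i
    rw [Subsingleton.elim i 0]
    exact pow_eq_zero_iff two_ne_zero |>.1 (h 0)
  · rintro rfl
    simp

lemma optValue_X_X_sq : optValue (X 0 : MvPolynomial (Fin 1) ℝ) (fun _ => X 0 ^ 2) = 0 := by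
  simp [optValue, feasibleSet_X_sq]

/-- Minimizing `x` over the double point `x² = 0` is exact at every positive order. -/
lemma relaxationFeasible_X_X_sq {d : ℕ} (hd : 1 ≤ d) {c : ℝ} (hc : c < 0) :
    RelaxationFeasible (X 0 : MvPolynomial (Fin 1) ℝ) (fun _ => X 0 ^ 2) d c := by
  obtain ⟨r, hr, hrc⟩ : ∃ r : ℝ, r ≠ 0 ∧ c = -r ^ 2 :=
    ⟨Real.sqrt (-c), (Real.sqrt_pos.2 (by linarith)).ne', by
      rw [Real.sq_sqrt (by linarith)]; ring⟩
  -- Completing the square: `x + r² = (r + x / (2r))² - x² / (4r²)`.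
  set s : MvPolynomial (Fin 1) ℝ := C r + C (1 / (2 * r)) * X 0
  have hs : s.totalDegree ≤ 1 := by
    refine (totalDegree_add _ _).trans (max_le (by simp) ?_)
    exact (totalDegree_mul _ _).trans (by rw [totalDegree_C, totalDegree_X])
  refine ⟨fun _ => C (-(1 / (2 * r)) ^ 2), s * s, ?_, fun _ => ?_, ?_, IsSumSq.mul_self s⟩
  · have h1 : (2 : MvPolynomial (Fin 1) ℝ) * C r * C (1 / (2 * r)) = 1 := by
      rw [← C_1, ← map_ofNat (C : ℝ →+* MvPolynomial (Fin 1) ℝ) 2, ← C_mul, ← C_mul]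
      congr 1
      field_simp
    simp only [Finset.univ_unique, Finset.sum_singleton, hrc, C_neg, C_pow, s]
    linear_combination (-(X 0 : MvPolynomial (Fin 1) ℝ)) * h1
  · refine (totalDegree_mul _ _).trans ?_
    rw [totalDegree_C, totalDegree_X_pow]
    omega
  · exact (totalDegree_mul _ _).trans (by omega)

/-- Here `σ = x - q * x²` would vanish at `0` with derivative `1`. -/
lemma not_relaxationFeasible_X_X_sq_zero (d : ℕ) :
    ¬ RelaxationFeasible (X 0 : MvPolynomial (Fin 1) ℝ) (fun _ => X 0 ^ 2) d 0 := by
  rintro ⟨q, σ, h, -, -, hσ⟩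
  simp only [C_0, sub_zero, Finset.univ_unique, Finset.sum_singleton] at h
  have h0 : eval (0 : Fin 1 → ℝ) σ = 0 := by
    have := congrArg (eval (0 : Fin 1 → ℝ)) h
    simpa using this.symm
  have h1 := congrArg (fun p => eval (0 : Fin 1 → ℝ) (pderiv 0 p)) h
  have h2 := eval_pderiv_eq_zero_of_isSumSq hσ _ h0 0
  rw [eval_zero] at h2
  simp [Derivation.leibniz, Derivation.leibniz_pow, h2] at h1

lemma noZeroAtInfinity_X_sq :
    NoZeroAtInfinity (fun _ => X 0 ^ 2 : Fin 1 → MvPolynomial (Fin 1) ℝ) := by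
  rintro ⟨z, hz, h⟩
  have h1 : topForm (X 0 ^ 2 : MvPolynomial (Fin 1) ℝ) = X 0 ^ 2 := by
    rw [topForm, totalDegree_X_pow]
    exact homogeneousComponent_eq_self (isHomogeneous_X_pow _ _)
  have h2 := h 0
  simp only [h1, map_pow, aeval_X] at h2
  apply hz
  funext i
  rw [Subsingleton.elim i 0]
  exact pow_eq_zero_iff two_ne_zero |>.1 h2

end Unattained

end Lasserre

end

theorem mainTheorem2 :
    (∀ (n : ℕ) (f : MvPolynomial (Fin n) ℝ) (g : Fin n → MvPolynomial (Fin n) ℝ),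
      Lasserre.NoZeroAtInfinity g →
      ∃ d : ℕ, (d : ℤ) ≤ Lasserre.degreeBound f g ∧
        Lasserre.relaxationValue f g d = Lasserre.optValue f g ∧
        ((∀ i, 1 ≤ (g i).totalDegree) →
          (1 ≤ f.totalDegree ∨ ∃ i, 2 ≤ (g i).totalDegree) →
          Lasserre.AdmissibleOrder g d)) ∧
    (∃ (n : ℕ) (f : MvPolynomial (Fin n) ℝ) (g : Fin n → MvPolynomial (Fin n) ℝ),
      Lasserre.NoZeroAtInfinity g ∧ (Lasserre.feasibleSet g).Nonempty ∧
      ∀ d : ℕ, Lasserre.AdmissibleOrder g d →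
        Lasserre.relaxationValue f g d = Lasserre.optValue f g ∧
        ¬ Lasserre.RelaxationAttained f g d) := by
  refine ⟨fun n f g hg => ⟨(Lasserre.degreeBound f g).toNat, ?_,
    Lasserre.relaxationValue_toNat_degreeBound hg,
    Lasserre.admissibleOrder_toNat_degreeBound⟩,
    1, X (0 : Fin 1), fun _ => X (0 : Fin 1) ^ 2, Lasserre.noZeroAtInfinity_X_sq, ?_, fun d hd => ?_⟩
  · rw [Int.toNat_of_nonneg (Lasserre.degreeBound_nonneg f g)]
  · rw [Lasserre.feasibleSet_X_sq]
    exact Set.singleton_nonempty _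
  · have hval : Lasserre.relaxationValue (X 0 : MvPolynomial (Fin 1) ℝ) (fun _ => X 0 ^ 2) d =
        Lasserre.optValue (X 0 : MvPolynomial (Fin 1) ℝ) (fun _ => X 0 ^ 2) := by
      refine Lasserre.relaxationValue_eq_optValue fun c hc => ?_
      rw [Lasserre.optValue_X_X_sq] at hc
      exact Lasserre.relaxationFeasible_X_X_sq hd.1 (by exact_mod_cast hc)
    refine ⟨hval, ?_⟩
    rintro ⟨c, hc, hc'⟩
    rw [hval, Lasserre.optValue_X_X_sq] at hc'
    have hc0 : c = 0 := by exact_mod_cast hc'.symm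
    subst hc0
    exact Lasserre.not_relaxationFeasible_X_X_sq_zero d hc
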